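/- Let $(X,d)$ be a metric space with a distinguished base point $0\in X$, let $F$ be a Banach space over $\mathbb K\in\{\mathbb R,\mathbb C\}$, and let $1\le p,q<\infty$, $0\le\theta,\nu<1$ and $1\le r<\infty$ satisfy $\frac1r+\frac{1-\theta}{p}+\frac{1-\nu}{q}=1$. For a Banach space $G$ let $\mathrm{Lip}(X,G)$ be the set of Lipschitz maps $T:X\to G$ with $T(0)=0$, and let $B_{X^\#}$ be the set of $1$-Lipschitz $f:X\to\mathbb R$ with $f(0)=0$. A map $S\in\mathrm{Lip}(X,G)$ is Lipschitz $p$-summing, $S\in\Pi_p^L(X,G)$, if there is $C\ge0$ such that for all $m\in\mathbb N$, $x'_j,x''_j\in X$ and $\lambda_j\ge 0$ $(1\le j\le m)$, $$\Big(\sum_{j=1}^m\lambda_j^p\|Sx'_j-Sx''_j\|^p\Big)^{1/p}\le C\sup_{f\in B_{X^\#}}\Big(\sum_{j=1}^m\lambda_j^p|f(x'_j)-f(x''_j)|^p\Big)^{1/p};$$ $\pi_p^L(S)$ is the infimum of such $C$. A bounded linear operator $R:E\to H$ between Banach spaces is $q$-summing, $R\in\Pi_q(E,H)$, if there is $C\ge0$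 such that $\big(\sum_{j=1}^m\|Re_j\|^q\big)^{1/q}\le C\sup_{a\in B_{E^*}}\big(\sum_{j=1}^m|\langle e_j,a\rangle|^q\big)^{1/q}$ for all $m\in\mathbb N$ and $e_1,\dots,e_m\in E$; $\pi_q(R)$ is the infimum of such $C$. A map $T\in\mathrm{Lip}(X,F)$ is Lipschitz $(p,\theta,q,\nu)$-dominated if there are Banach spaces $G,H$, a map $S\in\Pi_p^L(X,G)$, an operator $R\in\Pi_q(F^*,H)$ and a constant $C>0$ such that $$|\langle Tx'-Tx'',b^*\rangle|\le C\,d(x',x'')^\theta\,\|Sx'-Sx''\|^{1-\theta}\,\|b^*\|^\nu\,\|Rb^*\|^{1-\nu}\qquad(x',x''\in X,\ b^*\in F^*).\tag{$*$}$$ Let $\mathcal D^L_{(p,\theta,q,\nu)}(X,F)$ be the set of these maps, and let $$D^L_{(p,\theta,q,\nu)}(T)=\inf\, C\,\pi_p^L(S)^{1-\theta}\,\pi_q(R)^{1-\nu},$$ the infimum being over all $G,H,S,R,C$ admitted in $(*)$. Then $\mathcal D^L_{(p,\theta,q,\nu)}(X,F)$ is a linear space (with pointwise operations), $D^L_{(p,\theta,q,\nu)}$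 is a norm on it, and it is complete under this norm; that is, it is a Banach space. -/

import Mathlib

universe u v

noncomputable section

/-- `Lip(X,F)` for a metric space `X` with base point `x₀`: the Lipschitz maps `T : X → F` with
`T x₀ = 0`. In particular `X^# = LipMaps x₀ ℝ`. -/
def LipMaps {X : Type*} [MetricSpace X] (x₀ : X) (F : Type*) [NormedAddCommGroup F] :
    Set (X → F) :=
  {T | (∃ K, LipschitzWith K T) ∧ T x₀ = 0}

/-- The closed unit ball of `X^#` (with the norm `Lip(·)`). -/
def LipBall {X : Type*} [MetricSpace X] (x₀ : X) : Set (X → ℝ) :=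
  {f | f ∈ LipMaps x₀ ℝ ∧ LipschitzWith 1 f}

/-- The norm `‖(σ,x',x'') | ℓ_p^{L,w}(ℝ × X × X)‖` of a finite sequence. -/
def weakLipNorm {X : Type*} [MetricSpace X] (x₀ : X) (p : ℝ) {m : ℕ}
    (σ : Fin m → ℝ) (x' x'' : Fin m → X) : ℝ :=
  ⨆ f : LipBall x₀, (∑ j, |σ j| ^ p * |f.1 (x' j) - f.1 (x'' j)| ^ p) ^ (1 / p)

/-- `C` is an admissible constant in the definition of Lipschitz `p`-summing maps. -/
def IsLipSummingConst {X : Type*} [MetricSpace X] (x₀ : X) {G : Type*} [NormedAddCommGroup G]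
    (p : ℝ) (S : X → G) (C : ℝ) : Prop :=
  0 ≤ C ∧ ∀ (m : ℕ) (σ : Fin m → ℝ) (x' x'' : Fin m → X), (∀ j, 0 ≤ σ j) →
    (∑ j, |σ j| ^ p * dist (S (x' j)) (S (x'' j)) ^ p) ^ (1 / p) ≤ C * weakLipNorm x₀ p σ x' x''

/-- `S ∈ Π_p^L(X,G)`. -/
def IsLipSumming {X : Type*} [MetricSpace X] (x₀ : X) {G : Type*} [NormedAddCommGroup G]
    (p : ℝ) (S : X → G) : Prop :=
  S ∈ LipMaps x₀ G ∧ ∃ C, IsLipSummingConst x₀ p S C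

/-- The Lipschitz `p`-summing norm `π_p^L(S)`. -/
def lipSummingNorm {X : Type*} [MetricSpace X] (x₀ : X) {G : Type*} [NormedAddCommGroup G]
    (p : ℝ) (S : X → G) : ℝ :=
  sInf {C | IsLipSummingConst x₀ p S C}

/-- The norm `‖x | ℓ_q^w(E)‖` of a finite sequence in `E`. -/
def weakNorm (𝕜 : Type*) [RCLike 𝕜] {E : Type*} [NormedAddCommGroup E] [NormedSpace 𝕜 E]
    (q : ℝ) {m : ℕ} (x : Fin m → E) : ℝ :=
  ⨆ a : Metric.closedBall (0 : StrongDual 𝕜 E) 1, (∑ j, ‖a.1 (x j)‖ ^ q) ^ (1 / q)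

/-- `C` is an admissible constant in the definition of `q`-summing operators. -/
def IsSummingConst {𝕜 : Type*} [RCLike 𝕜] {E H : Type*} [NormedAddCommGroup E] [NormedSpace 𝕜 E]
    [NormedAddCommGroup H] [NormedSpace 𝕜 H] (q : ℝ) (R : E →L[𝕜] H) (C : ℝ) : Prop :=
  0 ≤ C ∧ ∀ (m : ℕ) (x : Fin m → E),
    (∑ j, ‖R (x j)‖ ^ q) ^ (1 / q) ≤ C * weakNorm 𝕜 q x

/-- `R ∈ Π_q(E,H)`. -/
def IsSumming {𝕜 : Type*} [RCLike 𝕜] {E H : Type*} [NormedAddCommGroup E] [NormedSpace 𝕜 E]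
    [NormedAddCommGroup H] [NormedSpace 𝕜 H] (q : ℝ) (R : E →L[𝕜] H) : Prop :=
  ∃ C, IsSummingConst q R C

/-- The `q`-summing norm `π_q(R)`. -/
def summingNorm {𝕜 : Type*} [RCLike 𝕜] {E H : Type*} [NormedAddCommGroup E] [NormedSpace 𝕜 E]
    [NormedAddCommGroup H] [NormedSpace 𝕜 H] (q : ℝ) (R : E →L[𝕜] H) : ℝ :=
  sInf {C | IsSummingConst q R C}

/-- The set of all numbers `C · π_p^L(S)^(1-θ) · π_q(R)^(1-ν)`, where `C > 0`, `S ∈ Π_p^L(X,G)`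
and `R ∈ Π_q(F*,H)` (for Banach spaces `G`, `H`) are such that
`|⟨Tx' - Tx'', b⟩| ≤ C d(x',x'')^θ ‖Sx' - Sx''‖^(1-θ) ‖b‖^ν ‖Rb‖^(1-ν)` for all `x', x'', b`.
Taking `G` in the universe of `X` and `H` in that of `F` loses nothing: `G` may be replaced by the
closed linear span of `S(X)`, and `H` by the closure of the range of `R`. -/
def dominationValues (𝕜 : Type*) [RCLike 𝕜] {X : Type u} [MetricSpace X] (x₀ : X)
    {F : Type v} [NormedAddCommGroup F] [NormedSpace 𝕜 F] (p θ q ν : ℝ) (T : X → F) : Set ℝ :=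
  {a | ∃ (G : Type u) (_ : NormedAddCommGroup G) (_ : NormedSpace 𝕜 G) (_ : CompleteSpace G)
      (H : Type v) (_ : NormedAddCommGroup H) (_ : NormedSpace 𝕜 H) (_ : CompleteSpace H)
      (S : X → G) (R : StrongDual 𝕜 F →L[𝕜] H) (C : ℝ),
      0 < C ∧ IsLipSumming x₀ p S ∧ IsSumming q R ∧
      (∀ (x' x'' : X) (b : StrongDual 𝕜 F),
        ‖b (T x' - T x'')‖ ≤
          C * dist x' x'' ^ θ * ‖S x' - S x''‖ ^ (1 - θ) * ‖b‖ ^ ν * ‖R b‖ ^ (1 - ν)) ∧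
      a = C * lipSummingNorm x₀ p S ^ (1 - θ) * summingNorm q R ^ (1 - ν)}

/-- The set `𝒟^L_{(p,θ,q,ν)}(X,F)` of Lipschitz `(p,θ,q,ν)`-dominated operators. -/
def LipDominated (𝕜 : Type*) [RCLike 𝕜] {X : Type u} [MetricSpace X] (x₀ : X)
    (F : Type v) [NormedAddCommGroup F] [NormedSpace 𝕜 F] (p θ q ν : ℝ) : Set (X → F) :=
  {T | T ∈ LipMaps x₀ F ∧ (dominationValues 𝕜 x₀ p θ q ν T).Nonempty}

/-- The norm `D^L_{(p,θ,q,ν)}(T)`. -/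
def lipDominatedNorm (𝕜 : Type*) [RCLike 𝕜] {X : Type u} [MetricSpace X] (x₀ : X)
    {F : Type v} [NormedAddCommGroup F] [NormedSpace 𝕜 F] (p θ q ν : ℝ) (T : X → F) : ℝ :=
  sInf (dominationValues 𝕜 x₀ p θ q ν T)

/-- The function `N` is a norm on the vector space `V`, and `V` is complete under it. -/
def IsBanachUnder (𝕜 : Type*) [RCLike 𝕜] (V : Type*) [AddCommGroup V] [Module 𝕜 V]
    (N : V → ℝ) : Prop :=
  letI : Norm V := ⟨N⟩
  ∃ core : NormedSpace.Core 𝕜 V,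
    letI : NormedAddCommGroup V := NormedAddCommGroup.ofCore core
    CompleteSpace V

end

/-! The exponent relation lets the three ingredients of a domination be rescaled against each other.
If `T` admits a domination of value below `D`, then `S`, `R` and the constant can be normalised so
that `D ^ (1 / p)` is admissible for `S`, `D ^ (1 / q)` is admissible for `R`, and the constant is
`D ^ (1 / r)`. Conversely, such data have value at most `D`, because the exponents `1/r`, `(1-θ)/p`,
`(1-ν)/q` add up to one.

In this form dominations can be added, even countably many at a time. Given normalised data for `T
i` with bounds `D i`, take the `ℓ_p`-sum of the maps `S i` and the `ℓ_q`-sum of the operators `R i`.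
Their `p`-th and `q`-th powers of summing constants add up to at most `∑ D i`, and Hölder's
inequality with the three exponents above combines the pointwise estimates into one for `∑ T i`.

So `D^L` is countably subadditive (`lipDominated_of_hasSum`). Two summands give the triangle
inequality; applied to the tails of an absolutely convergent series, the same statement gives
completeness. Definiteness, and the pointwise convergence of such series, come from `Lip(T) ≤
D^L(T)`. -/

/-- Hölder's inequality for three sequences with weights adding up to one. -/
theorem sum_rpow_mul_rpow_mul_rpow_le {ι : Type*} (s : Finset ι) {f g k : ι → ℝ}
    (hf : ∀ i, 0 ≤ f i) (hg : ∀ i, 0 ≤ g i) (hk : ∀ i, 0 ≤ k i) {A B C : ℝ}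
    (hA : ∑ i ∈ s, f i ≤ A) (hB : ∑ i ∈ s, g i ≤ B) (hC : ∑ i ∈ s, k i ≤ C)
    {a b c : ℝ} (ha : 0 < a) (hb : 0 < b) (hc : 0 < c) (habc : a + b + c = 1) :
    ∑ i ∈ s, f i ^ a * g i ^ b * k i ^ c ≤ A ^ a * B ^ b * C ^ c := by
  -- The main argument divides by `A`, `B` and `C`. If one of them is zero, its sequence vanishes on
  -- `s`, and since the exponents are positive the left-hand side is zero.
  have vanish : ∀ {f : ι → ℝ} {A : ℝ}, (∀ i, 0 ≤ f i) → ∑ i ∈ s, f i ≤ A → A = 0 →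
      ∀ i ∈ s, f i = 0 := by
    rintro f A hf hA rfl
    exact (Finset.sum_eq_zero_iff_of_nonneg fun i _ => hf i).1
      (le_antisymm hA (Finset.sum_nonneg fun i _ => hf i))
  have hA0 : 0 ≤ A := (Finset.sum_nonneg fun i _ => hf i).trans hA
  have hB0 : 0 ≤ B := (Finset.sum_nonneg fun i _ => hg i).trans hB
  have hC0 : 0 ≤ C := (Finset.sum_nonneg fun i _ => hk i).trans hC
  rcases hA0.eq_or_lt' with h0 | hA'
  · rw [Finset.sum_eq_zero fun i hi => by
      rw [vanish hf hA h0 i hi, Real.zero_rpow ha.ne', zero_mul, zero_mul]]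
    positivity
  rcases hB0.eq_or_lt' with h0 | hB'
  · rw [Finset.sum_eq_zero fun i hi => by
      rw [vanish hg hB h0 i hi, Real.zero_rpow hb.ne', mul_zero, zero_mul]]
    positivity
  rcases hC0.eq_or_lt' with h0 | hC'
  · rw [Finset.sum_eq_zero fun i hi => by
      rw [vanish hk hC h0 i hi, Real.zero_rpow hc.ne', mul_zero]]
    positivity
  -- Weighted AM-GM for the sequences normalised by their bounds; summed over `s`, the bracket is at
  -- most `a + b + c = 1`.
  have key : ∀ i ∈ s, f i ^ a * g i ^ b * k i ^ c ≤
      A ^ a * B ^ b * C ^ c * (a * (f i / A) + b * (g i / B) + c * (k i / C)) := by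
    intro i _
    have h := Real.geom_mean_le_arith_mean3_weighted ha.le hb.le hc.le
      (div_nonneg (hf i) hA0) (div_nonneg (hg i) hB0) (div_nonneg (hk i) hC0) habc
    rw [Real.div_rpow (hf i) hA0, Real.div_rpow (hg i) hB0, Real.div_rpow (hk i) hC0] at h
    refine le_trans (le_of_eq ?_) (mul_le_mul_of_nonneg_left h (by positivity))
    have := Real.rpow_pos_of_pos hA' a
    have := Real.rpow_pos_of_pos hB' b
    have := Real.rpow_pos_of_pos hC' c
    field_simp
  refine (Finset.sum_le_sum key).trans ?_
  rw [← Finset.mul_sum]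
  refine mul_le_of_le_one_right (by positivity) ?_
  rw [Finset.sum_add_distrib, Finset.sum_add_distrib, ← Finset.mul_sum, ← Finset.mul_sum,
    ← Finset.mul_sum, ← Finset.sum_div, ← Finset.sum_div, ← Finset.sum_div, ← habc]
  have h1 := (div_le_one hA').2 hA
  have h2 := (div_le_one hB').2 hB
  have h3 := (div_le_one hC').2 hC
  have := mul_le_mul_of_nonneg_left h1 ha.le
  have := mul_le_mul_of_nonneg_left h2 hb.le
  have := mul_le_mul_of_nonneg_left h3 hc.le
  linarith

/-! ### Summing maps and their `ℓ_p`-sums -/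

section Summing

variable {X : Type*} [MetricSpace X] {x₀ : X} {G : Type*} [NormedAddCommGroup G]
  {𝕜 : Type*} [RCLike 𝕜] {E H : Type*} [NormedAddCommGroup E] [NormedSpace 𝕜 E]
  [NormedAddCommGroup H] [NormedSpace 𝕜 H] {p q : ℝ}

theorem rpow_one_div_le_rpow_one_div_mul_iff {a D w : ℝ} (hp : 0 < p) (ha : 0 ≤ a) (hD : 0 ≤ D)
    (hw : 0 ≤ w) : a ^ (1 / p) ≤ D ^ (1 / p) * w ↔ a ≤ D * w ^ p := by
  have h : D ^ (1 / p) * w = (D * w ^ p) ^ (1 / p) := by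
    rw [Real.mul_rpow hD (by positivity), ← Real.rpow_mul hw, mul_one_div_cancel hp.ne',
      Real.rpow_one]
  rw [h, Real.rpow_le_rpow_iff ha (by positivity) (by positivity)]

theorem zero_mem_lipBall : (0 : X → ℝ) ∈ LipBall x₀ :=
  ⟨⟨⟨0, LipschitzWith.const 0⟩, rfl⟩, LipschitzWith.const' 0⟩

theorem weakLipNorm_nonneg {m : ℕ} (σ : Fin m → ℝ) (x' x'' : Fin m → X) :
    0 ≤ weakLipNorm x₀ p σ x' x'' :=
  Real.iSup_nonneg fun _ => by positivity

theorem weakNorm_nonneg {m : ℕ} (x : Fin m → E) : 0 ≤ weakNorm 𝕜 q x :=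
  Real.iSup_nonneg fun _ => by positivity

theorem weakLipNorm_single_le (hp : 0 < p) (x' x'' : X) :
    weakLipNorm x₀ p (fun _ : Fin 1 => 1) (fun _ => x') (fun _ => x'') ≤ dist x' x'' := by
  have : Nonempty (LipBall x₀) := ⟨⟨0, zero_mem_lipBall⟩⟩
  refine ciSup_le fun f => ?_
  rw [Fin.sum_univ_one, abs_one, Real.one_rpow, one_mul, ← Real.rpow_mul (abs_nonneg _),
    mul_one_div_cancel hp.ne', Real.rpow_one]
  simpa [Real.dist_eq] using f.2.2.dist_le_mul x' x''

theorem weakNorm_single_le (hq : 0 < q) (x : E) : weakNorm 𝕜 q (fun _ : Fin 1 => x) ≤ ‖x‖ := by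
  have : Nonempty (Metric.closedBall (0 : StrongDual 𝕜 E) 1) := ⟨⟨0, by simp⟩⟩
  refine ciSup_le fun a => ?_
  rw [Fin.sum_univ_one, ← Real.rpow_mul (norm_nonneg _), mul_one_div_cancel hq.ne', Real.rpow_one]
  exact a.1.le_of_opNorm_le_of_le (mem_closedBall_zero_iff.1 a.2) le_rfl |>.trans_eq (one_mul _)

theorem IsLipSummingConst.mono {S : X → G} {C C' : ℝ} (h : IsLipSummingConst x₀ p S C)
    (hC : C ≤ C') : IsLipSummingConst x₀ p S C' :=
  ⟨h.1.trans hC, fun m σ x' x'' hσ => (h.2 m σ x' x'' hσ).trans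
    (mul_le_mul_of_nonneg_right hC (weakLipNorm_nonneg _ _ _))⟩

theorem IsSummingConst.mono {R : E →L[𝕜] H} {C C' : ℝ} (h : IsSummingConst q R C)
    (hC : C ≤ C') : IsSummingConst q R C' :=
  ⟨h.1.trans hC, fun m x => (h.2 m x).trans
    (mul_le_mul_of_nonneg_right hC (weakNorm_nonneg _))⟩

/-- After taking `p`-th powers the condition is linear in `D`, so it can be summed over a family of
maps. -/
theorem isLipSummingConst_rpow_iff {S : X → G} {D : ℝ} (hp : 0 < p) (hD : 0 ≤ D) :
    IsLipSummingConst x₀ p S (D ^ (1 / p)) ↔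
      ∀ (m : ℕ) (σ : Fin m → ℝ) (x' x'' : Fin m → X), (∀ j, 0 ≤ σ j) →
        ∑ j, |σ j| ^ p * dist (S (x' j)) (S (x'' j)) ^ p ≤ D * weakLipNorm x₀ p σ x' x'' ^ p := by
  have h : 0 ≤ D ^ (1 / p) := by positivity
  simp only [IsLipSummingConst, h, true_and]
  refine forall₅_congr fun m σ x' x'' _ => ?_
  exact rpow_one_div_le_rpow_one_div_mul_iff hp (by positivity) hD (weakLipNorm_nonneg _ _ _)

theorem isSummingConst_rpow_iff {R : E →L[𝕜] H} {D : ℝ} (hq : 0 < q) (hD : 0 ≤ D) :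
    IsSummingConst q R (D ^ (1 / q)) ↔
      ∀ (m : ℕ) (x : Fin m → E), ∑ j, ‖R (x j)‖ ^ q ≤ D * weakNorm 𝕜 q x ^ q := by
  have h : 0 ≤ D ^ (1 / q) := by positivity
  simp only [IsSummingConst, h, true_and]
  refine forall₂_congr fun m x => ?_
  exact rpow_one_div_le_rpow_one_div_mul_iff hq (by positivity) hD (weakNorm_nonneg _)

/-- Test the summing inequality on a single pair with weight one. -/
theorem IsLipSummingConst.dist_le {S : X → G} {C : ℝ} (hp : 0 < p)
    (h : IsLipSummingConst x₀ p S C) (x' x'' : X) : dist (S x') (S x'') ≤ C * dist x' x'' := by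
  have h1 := h.2 1 (fun _ => 1) (fun _ => x') (fun _ => x'') fun _ => zero_le_one
  rw [Fin.sum_univ_one, abs_one, Real.one_rpow, one_mul, ← Real.rpow_mul dist_nonneg,
    mul_one_div_cancel hp.ne', Real.rpow_one] at h1
  exact h1.trans (mul_le_mul_of_nonneg_left (weakLipNorm_single_le hp x' x'') h.1)

theorem IsSummingConst.norm_le {R : E →L[𝕜] H} {C : ℝ} (hq : 0 < q)
    (h : IsSummingConst q R C) (x : E) : ‖R x‖ ≤ C * ‖x‖ := by
  have h1 := h.2 1 (fun _ => x)
  rw [Fin.sum_univ_one, ← Real.rpow_mul (norm_nonneg _), mul_one_div_cancel hq.ne',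
    Real.rpow_one] at h1
  exact h1.trans (mul_le_mul_of_nonneg_left (weakNorm_single_le hq x) h.1)

theorem IsLipSummingConst.isLipSumming {S : X → G} {C : ℝ} (hp : 0 < p)
    (h : IsLipSummingConst x₀ p S C) (hS : S x₀ = 0) : IsLipSumming x₀ p S :=
  ⟨⟨⟨C.toNNReal, LipschitzWith.of_dist_le_mul fun x y => by
    simpa [h.1] using h.dist_le hp x y⟩, hS⟩, C, h⟩

theorem IsLipSummingConst.lipSummingNorm_le {S : X → G} {C : ℝ} (h : IsLipSummingConst x₀ p S C) :
    lipSummingNorm x₀ p S ≤ C :=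
  csInf_le ⟨0, fun _ h => h.1⟩ h

theorem IsSummingConst.summingNorm_le {R : E →L[𝕜] H} {C : ℝ} (h : IsSummingConst q R C) :
    summingNorm q R ≤ C :=
  csInf_le ⟨0, fun _ h => h.1⟩ h

theorem lipSummingNorm_nonneg (S : X → G) : 0 ≤ lipSummingNorm x₀ p S :=
  Real.sInf_nonneg fun _ h => h.1

theorem summingNorm_nonneg (R : E →L[𝕜] H) : 0 ≤ summingNorm q R :=
  Real.sInf_nonneg fun _ h => h.1

theorem IsLipSumming.isLipSummingConst {S : X → G} (h : IsLipSumming x₀ p S) {C : ℝ}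
    (hC : lipSummingNorm x₀ p S < C) : IsLipSummingConst x₀ p S C := by
  obtain ⟨c, hc, hlt⟩ := exists_lt_of_csInf_lt h.2 hC
  exact IsLipSummingConst.mono hc hlt.le

theorem IsSumming.isSummingConst {R : E →L[𝕜] H} (h : IsSumming q R) {C : ℝ}
    (hC : summingNorm q R < C) : IsSummingConst q R C := by
  obtain ⟨c, hc, hlt⟩ := exists_lt_of_csInf_lt h hC
  exact IsSummingConst.mono hc hlt.le

theorem IsLipSummingConst.const_smul [NormedSpace 𝕜 G] {S : X → G} {C : ℝ} (hp : 0 < p)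
    (h : IsLipSummingConst x₀ p S C) (c : 𝕜) : IsLipSummingConst x₀ p (c • S) (‖c‖ * C) := by
  refine ⟨mul_nonneg (norm_nonneg _) h.1, fun m σ x' x'' hσ => ?_⟩
  have h1 : ∑ j, |σ j| ^ p * dist ((c • S) (x' j)) ((c • S) (x'' j)) ^ p =
      ‖c‖ ^ p * ∑ j, |σ j| ^ p * dist (S (x' j)) (S (x'' j)) ^ p := by
    rw [Finset.mul_sum]
    refine Finset.sum_congr rfl fun j _ => ?_
    rw [Pi.smul_apply, Pi.smul_apply, dist_smul₀, Real.mul_rpow (norm_nonneg _) dist_nonneg]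
    ring
  rw [h1, Real.mul_rpow (by positivity) (by positivity), ← Real.rpow_mul (norm_nonneg _),
    mul_one_div_cancel hp.ne', Real.rpow_one, mul_assoc]
  exact mul_le_mul_of_nonneg_left (h.2 m σ x' x'' hσ) (norm_nonneg _)

theorem IsSummingConst.const_smul {R : E →L[𝕜] H} {C : ℝ} (hq : 0 < q)
    (h : IsSummingConst q R C) (c : 𝕜) : IsSummingConst q (c • R) (‖c‖ * C) := by
  refine ⟨mul_nonneg (norm_nonneg _) h.1, fun m x => ?_⟩
  have h1 : ∑ j, ‖(c • R) (x j)‖ ^ q = ‖c‖ ^ q * ∑ j, ‖R (x j)‖ ^ q := by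
    rw [Finset.mul_sum]
    refine Finset.sum_congr rfl fun j _ => ?_
    rw [_root_.smul_apply, norm_smul, Real.mul_rpow (norm_nonneg _) (norm_nonneg _)]
  rw [h1, Real.mul_rpow (by positivity) (by positivity), ← Real.rpow_mul (norm_nonneg _),
    mul_one_div_cancel hq.ne', Real.rpow_one, mul_assoc]
  exact mul_le_mul_of_nonneg_left (h.2 m x) (norm_nonneg _)

/-- Lipschitz `p`-summing maps can be combined into one map to the `ℓ_p`-sum of the targets. -/
theorem exists_lp_isLipSummingConst {ι : Type*} {G : ι → Type*} [∀ i, NormedAddCommGroup (G i)]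
    (hp : 0 < p) [Fact (1 ≤ ENNReal.ofReal p)] {S : ∀ i, X → G i} {D : ι → ℝ} (hD : ∀ i, 0 ≤ D i)
    (hsum : Summable D) (hS₀ : ∀ i, S i x₀ = 0)
    (hS : ∀ i, IsLipSummingConst x₀ p (S i) (D i ^ (1 / p))) :
    ∃ T : X → lp G (ENNReal.ofReal p), T x₀ = 0 ∧
      IsLipSummingConst x₀ p T ((∑' i, D i) ^ (1 / p)) ∧
      ∀ x y, HasSum (fun i => ‖S i x - S i y‖ ^ p) (‖T x - T y‖ ^ p) := by
  have hpp : (ENNReal.ofReal p).toReal = p := ENNReal.toReal_ofReal hp.le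
  -- Comparing with the base point, where every `S i` vanishes, bounds `‖S i x‖ ^ p` by a summable
  -- sequence, so `(S i x)` lies in `ℓ_p`.
  have hbd : ∀ x i, ‖S i x‖ ^ p ≤ D i * dist x x₀ ^ p := by
    intro x i
    have h := (hS i).dist_le hp x x₀
    rw [hS₀, dist_zero_right] at h
    refine (Real.rpow_le_rpow (norm_nonneg _) h hp.le).trans_eq ?_
    rw [Real.mul_rpow (Real.rpow_nonneg (hD i) _) dist_nonneg, ← Real.rpow_mul (hD i),
      one_div_mul_cancel hp.ne', Real.rpow_one]
  have hmem : ∀ x, Memℓp (fun i => S i x) (ENNReal.ofReal p) := fun x => by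
    refine memℓp_gen ?_
    rw [hpp]
    exact Summable.of_nonneg_of_le (fun i => by positivity) (hbd x) (hsum.mul_right _)
  let T : X → lp G (ENNReal.ofReal p) := fun x => ⟨fun i => S i x, hmem x⟩
  have hT : ∀ x y, HasSum (fun i => ‖S i x - S i y‖ ^ p) (‖T x - T y‖ ^ p) := fun x y => by
    have := lp.hasSum_norm (by rwa [hpp]) (T x - T y)
    rwa [hpp] at this
  refine ⟨T, lp.ext (funext fun i => hS₀ i), ?_, hT⟩
  rw [isLipSummingConst_rpow_iff hp (tsum_nonneg hD)]
  intro m σ x' x'' hσ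
  have h1 : HasSum (fun i => ∑ j, |σ j| ^ p * dist (S i (x' j)) (S i (x'' j)) ^ p)
      (∑ j, |σ j| ^ p * dist (T (x' j)) (T (x'' j)) ^ p) := by
    refine hasSum_sum fun j _ => HasSum.mul_left _ ?_
    simpa only [dist_eq_norm] using hT (x' j) (x'' j)
  refine hasSum_le (fun i => ?_) h1 (hsum.hasSum.mul_right _)
  exact (isLipSummingConst_rpow_iff hp (hD i)).1 (hS i) m σ x' x'' hσ

/-- `q`-summing operators can be combined into one operator to the `ℓ_q`-sum of the targets. -/
theorem exists_lp_isSummingConst {ι : Type*} {H : ι → Type*} [∀ i, NormedAddCommGroup (H i)]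
    [∀ i, NormedSpace 𝕜 (H i)] (hq : 0 < q) [Fact (1 ≤ ENNReal.ofReal q)]
    {R : ∀ i, E →L[𝕜] H i} {D : ι → ℝ} (hD : ∀ i, 0 ≤ D i) (hsum : Summable D)
    (hR : ∀ i, IsSummingConst q (R i) (D i ^ (1 / q))) :
    ∃ T : E →L[𝕜] lp H (ENNReal.ofReal q), IsSummingConst q T ((∑' i, D i) ^ (1 / q)) ∧
      ∀ x, HasSum (fun i => ‖R i x‖ ^ q) (‖T x‖ ^ q) := by
  have hqq : (ENNReal.ofReal q).toReal = q := ENNReal.toReal_ofReal hq.le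
  have hbd : ∀ x i, ‖R i x‖ ^ q ≤ D i * ‖x‖ ^ q := by
    intro x i
    refine (Real.rpow_le_rpow (norm_nonneg _) ((hR i).norm_le hq x) hq.le).trans_eq ?_
    rw [Real.mul_rpow (Real.rpow_nonneg (hD i) _) (norm_nonneg _), ← Real.rpow_mul (hD i),
      one_div_mul_cancel hq.ne', Real.rpow_one]
  have hmem : ∀ x, Memℓp (fun i => R i x) (ENNReal.ofReal q) := fun x => by
    refine memℓp_gen ?_
    rw [hqq]
    exact Summable.of_nonneg_of_le (fun i => by positivity) (hbd x) (hsum.mul_right _)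
  let L : E →ₗ[𝕜] lp H (ENNReal.ofReal q) :=
    { toFun := fun x => ⟨fun i => R i x, hmem x⟩
      map_add' := fun x y => lp.ext (funext fun i => map_add (R i) x y)
      map_smul' := fun c x => lp.ext (funext fun i => map_smul (R i) c x) }
  have hL : ∀ x, HasSum (fun i => ‖R i x‖ ^ q) (‖L x‖ ^ q) := fun x => by
    have := lp.hasSum_norm (by rwa [hqq]) (L x)
    rwa [hqq] at this
  have hbound : ∀ x, ‖L x‖ ≤ (∑' i, D i) ^ (1 / q) * ‖x‖ := fun x => by
    have h1 := hasSum_le (hbd x) (hL x) (hsum.hasSum.mul_right _)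
    rw [← rpow_one_div_le_rpow_one_div_mul_iff hq (by positivity) (tsum_nonneg hD) (norm_nonneg _),
      ← Real.rpow_mul (norm_nonneg _), mul_one_div_cancel hq.ne', Real.rpow_one] at h1
    exact h1
  refine ⟨L.mkContinuous _ hbound, ?_, hL⟩
  rw [isSummingConst_rpow_iff hq (tsum_nonneg hD)]
  intro m x
  have h1 : HasSum (fun i => ∑ j, ‖R i (x j)‖ ^ q) (∑ j, ‖L (x j)‖ ^ q) :=
    hasSum_sum fun j _ => hL (x j)
  refine hasSum_le (fun i => ?_) h1 (hsum.hasSum.mul_right _)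
  exact (isSummingConst_rpow_iff hq (hD i)).1 (hR i) m x

end Summing

/-! ### Normalised dominations and their countable sums -/

/-- `T` satisfies the domination inequality with the constant `D ^ (1 / r)`, a map `S` of Lipschitz
`p`-summing norm at most `D ^ (1 / p)` and an operator `R` of `q`-summing norm at most
`D ^ (1 / q)`. -/
def IsDominationBound (𝕜 : Type*) [RCLike 𝕜] {X : Type u} [MetricSpace X] (x₀ : X)
    {F : Type v} [NormedAddCommGroup F] [NormedSpace 𝕜 F] (p θ q ν r : ℝ) (T : X → F)
    (D : ℝ) : Prop :=
  ∃ (G : Type u) (_ : NormedAddCommGroup G) (_ : NormedSpace 𝕜 G) (_ : CompleteSpace G)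
    (H : Type v) (_ : NormedAddCommGroup H) (_ : NormedSpace 𝕜 H) (_ : CompleteSpace H)
    (S : X → G) (R : StrongDual 𝕜 F →L[𝕜] H),
    S x₀ = 0 ∧ IsLipSummingConst x₀ p S (D ^ (1 / p)) ∧ IsSummingConst q R (D ^ (1 / q)) ∧
    ∀ (x' x'' : X) (b : StrongDual 𝕜 F),
      ‖b (T x' - T x'')‖ ≤
        D ^ (1 / r) * dist x' x'' ^ θ * ‖S x' - S x''‖ ^ (1 - θ) * ‖b‖ ^ ν * ‖R b‖ ^ (1 - ν)

section Domination

variable {𝕜 : Type*} [RCLike 𝕜] {X : Type u} [MetricSpace X] {x₀ : X}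
  {F : Type v} [NormedAddCommGroup F] [NormedSpace 𝕜 F] {p θ q ν r : ℝ}

theorem dominationValues_nonneg {T : X → F} {a : ℝ} (ha : a ∈ dominationValues 𝕜 x₀ p θ q ν T) :
    0 ≤ a := by
  obtain ⟨G, _, _, _, H, _, _, _, S, R, C, hC, -, -, -, rfl⟩ := ha
  have := lipSummingNorm_nonneg (x₀ := x₀) (p := p) S
  have := summingNorm_nonneg (q := q) R
  positivity

theorem lipDominatedNorm_le {T : X → F} {a : ℝ} (ha : a ∈ dominationValues 𝕜 x₀ p θ q ν T) :
    lipDominatedNorm 𝕜 x₀ p θ q ν T ≤ a :=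
  csInf_le ⟨0, fun _ h => dominationValues_nonneg h⟩ ha

theorem lipDominatedNorm_nonneg (T : X → F) : 0 ≤ lipDominatedNorm 𝕜 x₀ p θ q ν T :=
  Real.sInf_nonneg fun _ h => dominationValues_nonneg h

theorem rpow_mul_rpow_mul_rpow_eq_self {D : ℝ} (hD : 0 < D)
    (h : 1 / r + (1 - θ) / p + (1 - ν) / q = 1) :
    D ^ (1 / r) * (D ^ (1 / p)) ^ (1 - θ) * (D ^ (1 / q)) ^ (1 - ν) = D := by
  rw [← Real.rpow_mul hD.le, ← Real.rpow_mul hD.le, ← Real.rpow_add hD, ← Real.rpow_add hD,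
    one_div_mul_eq_div, one_div_mul_eq_div, h, Real.rpow_one]

/-- Multiplying `S` and `R` by suitable positive scalars normalises the data; the exponent relation
makes the remaining constant at most `D ^ (1 / r)`. -/
theorem isDominationBound_of_mem_dominationValues {T : X → F} {a D : ℝ} (hp : 0 < p) (hq : 0 < q)
    (hθ : θ < 1) (hν : ν < 1) (h : 1 / r + (1 - θ) / p + (1 - ν) / q = 1)
    (ha : a ∈ dominationValues 𝕜 x₀ p θ q ν T) (haD : a < D) :
    IsDominationBound 𝕜 x₀ p θ q ν r T D := by
  have hD : 0 < D := (dominationValues_nonneg ha).trans_lt haD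
  obtain ⟨G, _, _, _, H, _, _, _, S, R, C, hC, hS, hR, hT, rfl⟩ := ha
  set s := lipSummingNorm x₀ p S
  set t := summingNorm q R
  have hs0 : 0 ≤ s := lipSummingNorm_nonneg S
  have ht0 : 0 ≤ t := summingNorm_nonneg R
  -- The strict inequality `a < D` leaves room to enlarge `s` and `t`. Then `s + δ` and `t + δ` are
  -- admissible constants without the infima being attained, and they are positive even if `s` or
  -- `t` is zero, so they can be divided by.
  obtain ⟨δ, hδ, hδD⟩ : ∃ δ > 0, C * (s + δ) ^ (1 - θ) * (t + δ) ^ (1 - ν) < D := by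
    have hcont : ContinuousAt (fun δ : ℝ => C * (s + δ) ^ (1 - θ) * (t + δ) ^ (1 - ν)) 0 := by
      have h1 : ContinuousAt (fun δ : ℝ => (s + δ) ^ (1 - θ)) 0 :=
        (continuousAt_const.add continuousAt_id).rpow_const (Or.inr (by linarith))
      have h2 : ContinuousAt (fun δ : ℝ => (t + δ) ^ (1 - ν)) 0 :=
        (continuousAt_const.add continuousAt_id).rpow_const (Or.inr (by linarith))
      exact (continuousAt_const.mul h1).mul h2
    have hev := hcont.tendsto.eventually_lt_const (u := D) (by simpa using haD)
    have hev' := (hev.filter_mono (nhdsWithin_le_nhds (s := Set.Ioi 0))).and self_mem_nhdsWithin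
    obtain ⟨δ, h1, h2⟩ := hev'.exists
    exact ⟨δ, h2, h1⟩
  have hsδ : 0 < s + δ := by linarith
  have htδ : 0 < t + δ := by linarith
  set k : ℝ := D ^ (1 / p) / (s + δ) with hk
  set l : ℝ := D ^ (1 / q) / (t + δ) with hl
  have hk0 : 0 < k := by positivity
  have hl0 : 0 < l := by positivity
  have hkn : ‖(k : 𝕜)‖ = k := by rw [RCLike.norm_ofReal, abs_of_pos hk0]
  have hln : ‖(l : 𝕜)‖ = l := by rw [RCLike.norm_ofReal, abs_of_pos hl0]
  refine ⟨G, inferInstance, inferInstance, inferInstance, H, inferInstance, inferInstance,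
    inferInstance, (k : 𝕜) • S, (l : 𝕜) • R, ?_, ?_, ?_, ?_⟩
  · rw [Pi.smul_apply, hS.1.2, smul_zero]
  · have := (hS.isLipSummingConst (show s < s + δ by linarith)).const_smul hp (k : 𝕜)
    rwa [hkn, hk, div_mul_cancel₀ _ hsδ.ne'] at this
  · have := (hR.isSummingConst (show t < t + δ by linarith)).const_smul hq (l : 𝕜)
    rwa [hln, hl, div_mul_cancel₀ _ htδ.ne'] at this
  intro x' x'' b
  refine (hT x' x'' b).trans ?_
  have hCle : C ≤ D ^ (1 / r) * k ^ (1 - θ) * l ^ (1 - ν) := by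
    rw [hk, hl, Real.div_rpow (by positivity) hsδ.le, Real.div_rpow (by positivity) htδ.le]
    have e : D ^ (1 / r) * ((D ^ (1 / p)) ^ (1 - θ) / (s + δ) ^ (1 - θ)) *
        ((D ^ (1 / q)) ^ (1 - ν) / (t + δ) ^ (1 - ν)) =
        D / ((s + δ) ^ (1 - θ) * (t + δ) ^ (1 - ν)) := by
      rw [← mul_div_assoc (D ^ (1 / r)), div_mul_div_comm, rpow_mul_rpow_mul_rpow_eq_self hD h]
    rw [e, le_div_iff₀ (by positivity), ← mul_assoc]
    exact hδD.le
  have e1 : ‖((k : 𝕜) • S) x' - ((k : 𝕜) • S) x''‖ ^ (1 - θ) =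
      k ^ (1 - θ) * ‖S x' - S x''‖ ^ (1 - θ) := by
    rw [Pi.smul_apply, Pi.smul_apply, ← smul_sub, norm_smul, hkn,
      Real.mul_rpow hk0.le (norm_nonneg _)]
  have e2 : ‖((l : 𝕜) • R) b‖ ^ (1 - ν) = l ^ (1 - ν) * ‖R b‖ ^ (1 - ν) := by
    rw [_root_.smul_apply, norm_smul, hln, Real.mul_rpow hl0.le (norm_nonneg _)]
  rw [e1, e2]
  calc C * dist x' x'' ^ θ * ‖S x' - S x''‖ ^ (1 - θ) * ‖b‖ ^ ν * ‖R b‖ ^ (1 - ν)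
      ≤ (D ^ (1 / r) * k ^ (1 - θ) * l ^ (1 - ν)) * dist x' x'' ^ θ * ‖S x' - S x''‖ ^ (1 - θ) *
          ‖b‖ ^ ν * ‖R b‖ ^ (1 - ν) := by gcongr
    _ = _ := by ring

theorem IsDominationBound.exists_mem_dominationValues {T : X → F} {D : ℝ} (hp : 0 < p)
    (hθ : θ < 1) (hν : ν < 1) (h : 1 / r + (1 - θ) / p + (1 - ν) / q = 1) (hD : 0 < D)
    (hT : IsDominationBound 𝕜 x₀ p θ q ν r T D) :
    ∃ a ∈ dominationValues 𝕜 x₀ p θ q ν T, a ≤ D := by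
  obtain ⟨G, _, _, _, H, _, _, _, S, R, hS₀, hS, hR, hT⟩ := hT
  refine ⟨_, ⟨G, inferInstance, inferInstance, inferInstance, H, inferInstance, inferInstance,
    inferInstance, S, R, D ^ (1 / r), by positivity, hS.isLipSumming hp hS₀,
    ⟨_, hR⟩, hT, rfl⟩, ?_⟩
  refine le_trans ?_ (rpow_mul_rpow_mul_rpow_eq_self hD h).le
  have h1 := Real.rpow_le_rpow (lipSummingNorm_nonneg S) hS.lipSummingNorm_le
    (by linarith : 0 ≤ 1 - θ)
  have h2 := Real.rpow_le_rpow (summingNorm_nonneg R) hR.summingNorm_le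
    (by linarith : 0 ≤ 1 - ν)
  have := summingNorm_nonneg (q := q) R
  gcongr

/-- Bound `S` and `R` by their summing constants: the powers of the distance and of `‖b‖` recombine
to exponent one, the constants to `D`, and norming by functionals concludes. -/
theorem IsDominationBound.dist_le {T : X → F} {D : ℝ} (hp : 0 < p) (hq : 0 < q) (hθ : θ < 1)
    (hν : ν < 1) (h : 1 / r + (1 - θ) / p + (1 - ν) / q = 1) (hD : 0 < D)
    (hT : IsDominationBound 𝕜 x₀ p θ q ν r T D) (x' x'' : X) :
    dist (T x') (T x'') ≤ D * dist x' x'' := by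
  obtain ⟨G, _, _, _, H, _, _, _, S, R, hS₀, hS, hR, hT⟩ := hT
  have split : ∀ {y e : ℝ}, 0 ≤ y → e < 1 → y ^ e * y ^ (1 - e) = y := fun {y e} hy he => by
    rw [← Real.rpow_add' hy (by simp), add_sub_cancel, Real.rpow_one]
  rw [dist_eq_norm]
  refine NormedSpace.norm_le_dual_bound 𝕜 _ (by positivity) fun b => (hT x' x'' b).trans ?_
  have h1 : ‖S x' - S x''‖ ^ (1 - θ) ≤ (D ^ (1 / p) * dist x' x'') ^ (1 - θ) :=
    Real.rpow_le_rpow (norm_nonneg _) (by simpa only [dist_eq_norm] using hS.dist_le hp x' x'')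
      (by linarith)
  have h2 : ‖R b‖ ^ (1 - ν) ≤ (D ^ (1 / q) * ‖b‖) ^ (1 - ν) :=
    Real.rpow_le_rpow (norm_nonneg _) (hR.norm_le hq b) (by linarith)
  rw [Real.mul_rpow (by positivity) (by positivity)] at h1 h2
  calc D ^ (1 / r) * dist x' x'' ^ θ * ‖S x' - S x''‖ ^ (1 - θ) * ‖b‖ ^ ν * ‖R b‖ ^ (1 - ν)
      ≤ D ^ (1 / r) * dist x' x'' ^ θ * ((D ^ (1 / p)) ^ (1 - θ) * dist x' x'' ^ (1 - θ)) *
          ‖b‖ ^ ν * ((D ^ (1 / q)) ^ (1 - ν) * ‖b‖ ^ (1 - ν)) := by gcongr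
    _ = (D ^ (1 / r) * (D ^ (1 / p)) ^ (1 - θ) * (D ^ (1 / q)) ^ (1 - ν)) *
          (dist x' x'' ^ θ * dist x' x'' ^ (1 - θ)) * (‖b‖ ^ ν * ‖b‖ ^ (1 - ν)) := by ring
    _ = D * dist x' x'' * ‖b‖ := by
      rw [rpow_mul_rpow_mul_rpow_eq_self hD h, split dist_nonneg hθ, split (norm_nonneg _) hν]

/-- Hölder's inequality matches the `ℓ_p`-sum of the `S i`, the `ℓ_q`-sum of the `R i` and the sum
of the `D i`. Indexing by `ι : Type` keeps the two sums in the universes of `X` and `F`. -/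
theorem isDominationBound_of_hasSum {ι : Type} {T : ι → X → F} {U : X → F} {D : ι → ℝ}
    (hp : 1 ≤ p) (hq : 1 ≤ q) (hr : 0 < r) (hθ : θ < 1) (hν : ν < 1)
    (h : 1 / r + (1 - θ) / p + (1 - ν) / q = 1) (hD : ∀ i, 0 ≤ D i) (hsum : Summable D)
    (hT : ∀ i, IsDominationBound 𝕜 x₀ p θ q ν r (T i) (D i))
    (hU : ∀ x, HasSum (fun i => T i x) (U x)) :
    IsDominationBound 𝕜 x₀ p θ q ν r U (∑' i, D i) := by
  have hp0 : 0 < p := by linarith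
  have hq0 : 0 < q := by linarith
  choose G _ _ _ H _ _ _ S R hS₀ hS hR hT using hT
  have : Fact (1 ≤ ENNReal.ofReal p) := ⟨by simpa using hp⟩
  have : Fact (1 ≤ ENNReal.ofReal q) := ⟨by simpa using hq⟩
  obtain ⟨S', hS'₀, hS', hSsum⟩ := exists_lp_isLipSummingConst hp0 hD hsum hS₀ hS
  obtain ⟨R', hR', hRsum⟩ := exists_lp_isSummingConst hq0 hD hsum hR
  refine ⟨lp G (ENNReal.ofReal p), _, inferInstance, inferInstance, lp H (ENNReal.ofReal q), _, _,
    inferInstance, S', R', hS'₀, hS', hR', fun x' x'' b => ?_⟩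
  have hb : HasSum (fun i => b (T i x' - T i x'')) (b (U x' - U x'')) :=
    b.hasSum ((hU x').sub (hU x''))
  -- It suffices to bound finite partial sums by a quantity independent of `s`.
  refine le_of_tendsto hb.norm (Filter.Eventually.of_forall fun s => ?_)
  have conv : ∀ {y e t : ℝ}, 0 ≤ y → 0 < t → (y ^ t) ^ (e / t) = y ^ e := fun {y e t} hy ht => by
    rw [← Real.rpow_mul hy, mul_div_cancel₀ _ ht.ne']
  have hol := sum_rpow_mul_rpow_mul_rpow_le s hD
    (fun i => Real.rpow_nonneg (norm_nonneg (S i x' - S i x'')) p)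
    (fun i => Real.rpow_nonneg (norm_nonneg (R i b)) q)
    (hsum.sum_le_tsum s fun i _ => hD i)
    (sum_le_hasSum s (fun i _ => by positivity) (hSsum x' x''))
    (sum_le_hasSum s (fun i _ => by positivity) (hRsum b))
    (one_div_pos.2 hr) (div_pos (sub_pos.2 hθ) hp0) (div_pos (sub_pos.2 hν) hq0) h
  simp only [conv (norm_nonneg _) hp0, conv (norm_nonneg _) hq0] at hol
  calc ‖∑ i ∈ s, b (T i x' - T i x'')‖
      ≤ ∑ i ∈ s, D i ^ (1 / r) * dist x' x'' ^ θ * ‖S i x' - S i x''‖ ^ (1 - θ) * ‖b‖ ^ ν *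
          ‖R i b‖ ^ (1 - ν) := norm_sum_le_of_le _ fun i _ => hT i x' x'' b
    _ = dist x' x'' ^ θ * ‖b‖ ^ ν *
          ∑ i ∈ s, D i ^ (1 / r) * ‖S i x' - S i x''‖ ^ (1 - θ) * ‖R i b‖ ^ (1 - ν) := by
      rw [Finset.mul_sum]
      exact Finset.sum_congr rfl fun i _ => by ring
    _ ≤ dist x' x'' ^ θ * ‖b‖ ^ ν * ((∑' i, D i) ^ (1 / r) * ‖S' x' - S' x''‖ ^ (1 - θ) *
          ‖R' b‖ ^ (1 - ν)) := by gcongr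
    _ = _ := by ring

theorem zero_mem_dominationValues (hp : 0 < p) (hq : 0 < q) (hθ : θ < 1) :
    0 ∈ dominationValues 𝕜 x₀ p θ q ν (0 : X → F) := by
  have hS : IsLipSummingConst x₀ p (0 : X → PUnit.{u + 1}) 0 :=
    ⟨le_rfl, fun m σ x' x'' _ => by
      simp [Real.zero_rpow hp.ne', Real.zero_rpow (inv_pos.2 hp).ne']⟩
  have hR : IsSummingConst q (0 : StrongDual 𝕜 F →L[𝕜] PUnit.{v + 1}) 0 :=
    ⟨le_rfl, fun m x => by
      simp [Real.zero_rpow hq.ne', Real.zero_rpow (inv_pos.2 hq).ne']⟩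
  refine ⟨PUnit, inferInstance, inferInstance, inferInstance, PUnit, inferInstance, inferInstance,
    inferInstance, 0, 0, 1, one_pos, hS.isLipSumming hp rfl, ⟨0, hR⟩, fun x' x'' b => ?_, ?_⟩
  · simp only [Pi.zero_apply, sub_self, map_zero, norm_zero]
    positivity
  · rw [le_antisymm hS.lipSummingNorm_le (lipSummingNorm_nonneg _),
      Real.zero_rpow (by linarith), mul_zero, zero_mul]

/-- The scalar is absorbed into the constant `C`, which must stay positive; hence `c ≠ 0`. -/
theorem smul_mem_dominationValues {T : X → F} {a : ℝ} (c : 𝕜) (hc : c ≠ 0)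
    (ha : a ∈ dominationValues 𝕜 x₀ p θ q ν T) :
    ‖c‖ * a ∈ dominationValues 𝕜 x₀ p θ q ν (c • T) := by
  obtain ⟨G, _, _, _, H, _, _, _, S, R, C, hC, hS, hR, hT, rfl⟩ := ha
  refine ⟨G, inferInstance, inferInstance, inferInstance, H, inferInstance, inferInstance,
    inferInstance, S, R, ‖c‖ * C, by positivity, hS, hR, fun x' x'' b => ?_,
    by ring⟩
  rw [Pi.smul_apply, Pi.smul_apply, ← smul_sub, map_smul, norm_smul]
  refine (mul_le_mul_of_nonneg_left (hT x' x'' b) (norm_nonneg _)).trans_eq ?_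
  ring

end Domination

/-- Completeness is tested on absolutely convergent series. -/
theorem isBanachUnder_of_summable {𝕜 : Type*} [RCLike 𝕜] {V : Type*} [AddCommGroup V] [Module 𝕜 V]
    {N : V → ℝ} (h0 : ∀ x, 0 ≤ N x) (hsmul : ∀ (c : 𝕜) x, N (c • x) = ‖c‖ * N x)
    (hadd : ∀ x y, N (x + y) ≤ N x + N y) (hdef : ∀ x, N x = 0 → x = 0)
    (hsum : ∀ u : ℕ → V, Summable (fun i => N (u i)) →
      ∃ a, Filter.Tendsto (fun n => N (∑ i ∈ Finset.range n, u i - a)) Filter.atTop (nhds 0)) :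
    IsBanachUnder 𝕜 V N := by
  let _ : Norm V := ⟨N⟩
  have core : NormedSpace.Core 𝕜 V :=
    { norm_nonneg := h0
      norm_smul := hsmul
      norm_triangle := hadd
      norm_eq_zero_iff := fun x => ⟨hdef x, fun hx => by
        have := hsmul 0 x
        rw [zero_smul, norm_zero, zero_mul] at this
        rw [hx]
        exact this⟩ }
  refine ⟨core, ?_⟩
  let _ : NormedAddCommGroup V := NormedAddCommGroup.ofCore core
  refine NormedAddCommGroup.completeSpace_of_summable_imp_tendsto fun w hw => ?_
  obtain ⟨a, ha⟩ := hsum w hw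
  exact ⟨a, tendsto_iff_norm_sub_tendsto_zero.2 ha⟩

/-! ### `D^L` as a countably subadditive norm -/

section Norm

variable {𝕜 : Type*} [RCLike 𝕜] {X : Type u} [MetricSpace X] {x₀ : X}
  {F : Type v} [NormedAddCommGroup F] [NormedSpace 𝕜 F] {p θ q ν r : ℝ}

theorem isDominationBound_of_lipDominatedNorm_lt {T : X → F} {D : ℝ} (hp : 0 < p) (hq : 0 < q)
    (hθ : θ < 1) (hν : ν < 1) (h : 1 / r + (1 - θ) / p + (1 - ν) / q = 1)
    (hT : T ∈ LipDominated 𝕜 x₀ F p θ q ν) (hD : lipDominatedNorm 𝕜 x₀ p θ q ν T < D) :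
    IsDominationBound 𝕜 x₀ p θ q ν r T D := by
  obtain ⟨a, ha, haD⟩ := exists_lt_of_csInf_lt hT.2 hD
  exact isDominationBound_of_mem_dominationValues hp hq hθ hν h ha haD

/-- Each `D` above the infimum is a Lipschitz constant; let `D` decrease to it. -/
theorem dist_le_lipDominatedNorm_mul {T : X → F} (hp : 0 < p) (hq : 0 < q)
    (hθ : θ < 1) (hν : ν < 1) (h : 1 / r + (1 - θ) / p + (1 - ν) / q = 1)
    (hT : T ∈ LipDominated 𝕜 x₀ F p θ q ν) (x y : X) :
    dist (T x) (T y) ≤ lipDominatedNorm 𝕜 x₀ p θ q ν T * dist x y := by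
  have hcont : Filter.Tendsto (fun D : ℝ => D * dist x y)
      (nhdsWithin (lipDominatedNorm 𝕜 x₀ p θ q ν T) (Set.Ioi (lipDominatedNorm 𝕜 x₀ p θ q ν T)))
      (nhds (lipDominatedNorm 𝕜 x₀ p θ q ν T * dist x y)) :=
    ((continuous_id.mul continuous_const).tendsto _).mono_left nhdsWithin_le_nhds
  refine ge_of_tendsto hcont (Filter.eventually_of_mem self_mem_nhdsWithin fun D hD => ?_)
  exact (isDominationBound_of_lipDominatedNorm_lt hp hq hθ hν h hT hD).dist_le hp hq hθ hν h
    ((lipDominatedNorm_nonneg T).trans_lt hD) x y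

/-- Countable subadditivity of `D^L_{(p,θ,q,ν)}`. -/
theorem lipDominated_of_hasSum {ι : Type} [Encodable ι] [Nonempty ι] {T : ι → X → F} {U : X → F}
    (hp : 1 ≤ p) (hq : 1 ≤ q) (hr : 0 < r) (hθ : θ < 1) (hν : ν < 1)
    (h : 1 / r + (1 - θ) / p + (1 - ν) / q = 1)
    (hT : ∀ i, T i ∈ LipDominated 𝕜 x₀ F p θ q ν)
    (hsum : Summable fun i => lipDominatedNorm 𝕜 x₀ p θ q ν (T i))
    (hU : ∀ x, HasSum (fun i => T i x) (U x)) :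
    U ∈ LipDominated 𝕜 x₀ F p θ q ν ∧
      lipDominatedNorm 𝕜 x₀ p θ q ν U ≤ ∑' i, lipDominatedNorm 𝕜 x₀ p θ q ν (T i) := by
  have hp0 : 0 < p := by linarith
  have hq0 : 0 < q := by linarith
  have key : ∀ ε > 0, ∃ D, 0 < D ∧ IsDominationBound 𝕜 x₀ p θ q ν r U D ∧
      D ≤ ∑' i, lipDominatedNorm 𝕜 x₀ p θ q ν (T i) + ε := by
    intro ε hε
    -- Distributing `ε` over the indices gives each `T i` a bound strictly above its norm, at total
    -- extra cost `c ≤ ε`.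
    obtain ⟨δ, hδ, c, hδc, hc⟩ := posSumOfEncodable hε ι
    have hDpos : ∀ i, 0 < lipDominatedNorm 𝕜 x₀ p θ q ν (T i) + δ i := fun i =>
      add_pos_of_nonneg_of_pos (lipDominatedNorm_nonneg _) (hδ i)
    have hDsum := hsum.add hδc.summable
    refine ⟨_, hDsum.tsum_pos (fun i => (hDpos i).le) (Classical.arbitrary ι) (hDpos _),
      isDominationBound_of_hasSum hp hq hr hθ hν h (fun i => (hDpos i).le) hDsum
        (fun i => isDominationBound_of_lipDominatedNorm_lt hp0 hq0 hθ hν h (hT i)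
          (lt_add_of_pos_right _ (hδ i))) hU, ?_⟩
    rw [hsum.tsum_add hδc.summable, hδc.tsum_eq]
    gcongr
  refine ⟨⟨⟨?_, ?_⟩, ?_⟩, ?_⟩
  · obtain ⟨D, hD, hUD, -⟩ := key 1 one_pos
    exact ⟨D.toNNReal, LipschitzWith.of_dist_le_mul fun x y => by
      simpa [hD.le] using hUD.dist_le hp0 hq0 hθ hν h hD x y⟩
  · refine (hU x₀).unique ?_
    simpa only [(hT _).1.2] using (hasSum_zero : HasSum (fun _ : ι => (0 : F)) 0)
  · obtain ⟨D, hD, hUD, -⟩ := key 1 one_pos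
    obtain ⟨a, ha, -⟩ := hUD.exists_mem_dominationValues hp0 hθ hν h hD
    exact ⟨a, ha⟩
  · refine le_of_forall_pos_le_add fun ε hε => ?_
    obtain ⟨D, hD, hUD, hDε⟩ := key ε hε
    obtain ⟨a, ha, haD⟩ := hUD.exists_mem_dominationValues hp0 hθ hν h hD
    exact (lipDominatedNorm_le ha).trans (haD.trans hDε)

/-- Countable subadditivity for the family indexed by `Bool`. -/
theorem lipDominated_add {T U : X → F} (hp : 1 ≤ p) (hq : 1 ≤ q) (hr : 0 < r) (hθ : θ < 1)
    (hν : ν < 1) (h : 1 / r + (1 - θ) / p + (1 - ν) / q = 1)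
    (hT : T ∈ LipDominated 𝕜 x₀ F p θ q ν) (hU : U ∈ LipDominated 𝕜 x₀ F p θ q ν) :
    T + U ∈ LipDominated 𝕜 x₀ F p θ q ν ∧ lipDominatedNorm 𝕜 x₀ p θ q ν (T + U) ≤
      lipDominatedNorm 𝕜 x₀ p θ q ν T + lipDominatedNorm 𝕜 x₀ p θ q ν U := by
  have := lipDominated_of_hasSum (T := fun i : Bool => cond i T U) (U := T + U) hp hq hr hθ hν h
    (fun i => by cases i <;> assumption) Summable.of_finite (fun x => by
      simpa using hasSum_fintype (fun i : Bool => (cond i T U) x))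
  simpa using this

theorem zero_mem_lipDominated (hp : 0 < p) (hq : 0 < q) (hθ : θ < 1) :
    (0 : X → F) ∈ LipDominated 𝕜 x₀ F p θ q ν :=
  ⟨⟨⟨0, LipschitzWith.const 0⟩, rfl⟩, 0, zero_mem_dominationValues hp hq hθ⟩

theorem lipDominatedNorm_zero (hp : 0 < p) (hq : 0 < q) (hθ : θ < 1) :
    lipDominatedNorm 𝕜 x₀ p θ q ν (0 : X → F) = 0 :=
  le_antisymm (lipDominatedNorm_le (zero_mem_dominationValues hp hq hθ)) (lipDominatedNorm_nonneg _)

theorem smul_mem_lipDominated {T : X → F} (hp : 0 < p) (hq : 0 < q) (hθ : θ < 1) (c : 𝕜)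
    (hT : T ∈ LipDominated 𝕜 x₀ F p θ q ν) : c • T ∈ LipDominated 𝕜 x₀ F p θ q ν := by
  rcases eq_or_ne c 0 with rfl | hc
  · rw [zero_smul]
    exact zero_mem_lipDominated hp hq hθ
  obtain ⟨⟨⟨K, hK⟩, hT₀⟩, a, ha⟩ := hT
  exact ⟨⟨⟨_, (lipschitzWith_smul c).comp hK⟩, by rw [Pi.smul_apply, hT₀, smul_zero]⟩,
    _, smul_mem_dominationValues c hc ha⟩

theorem lipDominatedNorm_smul {T : X → F} (hp : 0 < p) (hq : 0 < q) (hθ : θ < 1) (c : 𝕜)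
    (hT : T ∈ LipDominated 𝕜 x₀ F p θ q ν) :
    lipDominatedNorm 𝕜 x₀ p θ q ν (c • T) = ‖c‖ * lipDominatedNorm 𝕜 x₀ p θ q ν T := by
  rcases eq_or_ne c 0 with rfl | hc
  · rw [zero_smul, norm_zero, zero_mul, lipDominatedNorm_zero hp hq hθ]
  have le : ∀ {c : 𝕜} {T : X → F}, c ≠ 0 → T ∈ LipDominated 𝕜 x₀ F p θ q ν →
      lipDominatedNorm 𝕜 x₀ p θ q ν (c • T) ≤ ‖c‖ * lipDominatedNorm 𝕜 x₀ p θ q ν T := by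
    intro c T hc hT
    rw [← div_le_iff₀' (norm_pos_iff.2 hc)]
    refine le_csInf hT.2 fun a ha => ?_
    rw [div_le_iff₀' (norm_pos_iff.2 hc)]
    exact lipDominatedNorm_le (smul_mem_dominationValues c hc ha)
  refine le_antisymm (le hc hT) ?_
  -- The reverse inequality is the same bound applied to `c⁻¹` and `c • T`.
  have := le (inv_ne_zero hc) (smul_mem_lipDominated hp hq hθ c hT)
  rwa [inv_smul_smul₀ hc, norm_inv, le_inv_mul_iff₀ (norm_pos_iff.2 hc)] at this

end Norm

/-! ### The Banach space of dominated maps -/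

theorem mainTheorem4 {𝕜 : Type*} [RCLike 𝕜] {X : Type u} [MetricSpace X] (x₀ : X)
    {F : Type v} [NormedAddCommGroup F] [NormedSpace 𝕜 F] [CompleteSpace F]
    (p θ q ν r : ℝ) (hp : 1 ≤ p) (hq : 1 ≤ q) (hr : 1 ≤ r)
    (hθ₀ : 0 ≤ θ) (hθ₁ : θ < 1) (hν₀ : 0 ≤ ν) (hν₁ : ν < 1)
    (h : 1 / r + (1 - θ) / p + (1 - ν) / q = 1) :
    ∃ V : Submodule 𝕜 (X → F), (V : Set (X → F)) = LipDominated 𝕜 x₀ F p θ q ν ∧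
      IsBanachUnder 𝕜 V (fun T => lipDominatedNorm 𝕜 x₀ p θ q ν (T : X → F)) := by
  have hp0 : 0 < p := by linarith
  have hq0 : 0 < q := by linarith
  have hr0 : 0 < r := by linarith
  let V : Submodule 𝕜 (X → F) :=
    { carrier := LipDominated 𝕜 x₀ F p θ q ν
      add_mem' := fun hT hU => (lipDominated_add hp hq hr0 hθ₁ hν₁ h hT hU).1
      zero_mem' := zero_mem_lipDominated hp0 hq0 hθ₁
      smul_mem' := fun c _ hT => smul_mem_lipDominated hp0 hq0 hθ₁ c hT }
  have norm_le : ∀ (T : V) (x : X),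
      ‖(T : X → F) x‖ ≤ lipDominatedNorm 𝕜 x₀ p θ q ν (T : X → F) * dist x x₀ := fun T x => by
    simpa [T.2.1.2] using dist_le_lipDominatedNorm_mul hp0 hq0 hθ₁ hν₁ h T.2 x x₀
  refine ⟨V, rfl, isBanachUnder_of_summable (fun T => lipDominatedNorm_nonneg _)
    (fun c T => lipDominatedNorm_smul hp0 hq0 hθ₁ c T.2)
    (fun T U => (lipDominated_add hp hq hr0 hθ₁ hν₁ h T.2 U.2).2) (fun T hT => ?_)
    fun T hT => ?_⟩
  · ext x
    have := norm_le T x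
    rw [hT, zero_mul] at this
    exact norm_le_zero_iff.1 this
  -- Norm summability forces pointwise absolute convergence in the complete space `F`; the pointwise
  -- sum is the candidate limit.
  have hpt : ∀ x, Summable fun i => (T i : X → F) x := fun x =>
    Summable.of_norm_bounded (hT.mul_right (dist x x₀)) fun i => norm_le (T i) x
  let U : V := ⟨fun x => ∑' i, (T i : X → F) x,
    (lipDominated_of_hasSum hp hq hr0 hθ₁ hν₁ h (fun i => (T i).2) hT
      fun x => (hpt x).hasSum).1⟩
  refine ⟨U, squeeze_zero (fun n => lipDominatedNorm_nonneg _) (fun n => ?_)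
    (tendsto_sum_nat_add fun i => lipDominatedNorm 𝕜 x₀ p θ q ν (T i : X → F))⟩
  -- The error is minus the tail of the series, whose norm is at most the tail of the summed norms
  -- by countable subadditivity.
  have hneg : ((∑ i ∈ Finset.range n, T i - U : V) : X → F) =
      (-1 : 𝕜) • fun x => ∑' i, (T (i + n) : X → F) x := by
    funext x
    have := (hpt x).sum_add_tsum_nat_add n
    simp only [Submodule.coe_sub, Submodule.coe_sum, Pi.sub_apply, Finset.sum_apply,
      Pi.smul_apply, neg_smul, one_smul, U]
    rw [← this]
    abel
  have htail := lipDominated_of_hasSum hp hq hr0 hθ₁ hν₁ h (fun i => (T (i + n)).2)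
    ((summable_nat_add_iff n).2 hT) fun x => ((summable_nat_add_iff n).2 (hpt x)).hasSum
  simp only [hneg]
  rw [lipDominatedNorm_smul hp0 hq0 hθ₁ _ htail.1, norm_neg, norm_one, one_mul]
  exact htail.2
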